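/- Let $\mathbb T=\mathbb R\cup\{-\infty\}$ be the max-plus semiring (addition is maximum, multiplication is the usual sum, zero is $-\infty$, unit is $0$), and let $\mathrm{TMat}_3(\mathbb T)$ be the multiplicative monoid of upper triangular $3\times3$ matrices over $\mathbb T$. Let $\mathcal P_3$ be the plactic monoid of rank $3$: the quotient of the free monoid on the ordered alphabet $a_1<a_2<a_3$ by the congruence generated by the Knuth relations $acb=cab$ for letters $a\le b<c$, and $bac=bca$ for letters $a<b\le c$. A semigroup $S$ satisfies a semigroup identity $p=q$, where $p,q$ are elements of a free semigroup $\mathcal A^+$, if $\phi(p)=\phi(q)$ for every homomorphism $\phi:\mathcal A^+\to S$. (1) The monoid $\mathcal P_3$ satisfies every semigroup identity satisfied by $\mathrm{TMat}_3(\mathbb T)$. (2) In particular, let $\widetilde w=\widetilde w(x,y)$ be a uniform word over $\{x,y\}$ (all its letters occur in it the same number of times) such that $\widetilde w$, $\widetilde w x\widetilde w$ and $\widetilde w y\widetilde w$ are $2$-power words with exponent bound $2$; that is, they are nonempty words in which no letter occurs more than twice in succession and which contain, as a contiguous factor, every word of length $2$ over $\{x,y\}$ in which no letter occurs more than twice in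 succession. Then, for all $u,v\in\mathcal P_3$, the identity $$\Pi_{(C,2,2)}:\quad \widetilde w\, x\,\widetilde w=\widetilde w\, y\,\widetilde w$$ holds in $\mathcal P_3$ with $x=uv$ and $y=vu$. (3) In particular, for all $u,v\in\mathcal P_3$, with $x=uv$ and $y=vu$, $$yx^2y^2x\cdot x\cdot yx^2y^2x = yx^2y^2x\cdot y\cdot yx^2y^2x .$$ -/

import Mathlib

/-! ## Words and semigroup identities -/

/-- The semigroup `S` satisfies the semigroup identity `u = v`, where `u` and `v` are elements of
the free semigroup on an alphabet `α`: every semigroup homomorphism from the free semigroup to `S`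
takes the same value on `u` and on `v`. -/
def SatisfiesIdentity (S : Type*) [Mul S] {α : Type*} (u v : FreeSemigroup α) : Prop :=
  ∀ φ : FreeSemigroup α →ₙ* S, φ u = φ v

/-- The word `u` is a factor (contiguous subword) of the word `w`. -/
def IsFactor {C : Type*} (u w : FreeMonoid C) : Prop :=
  ∃ v₁ v₂ : FreeMonoid C, w = v₁ * u * v₂

/-- No letter appears more than `p` times sequentially in the word `w`. -/
def RunsAtMost {C : Type*} (p : ℕ) (w : FreeMonoid C) : Prop :=
  ∀ (a : C) (q : ℕ), p < q → ¬ IsFactor (FreeMonoid.of a ^ q) w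

/-- `w` is an `n`-power word over the alphabet `C` with exponent bound `p`: it is nonempty, no
letter appears more than `p` times sequentially in it, and every word of length `n` in which no
letter appears more than `p` times sequentially is a factor of it. -/
structure IsPowerWord {C : Type*} (p n : ℕ) (w : FreeMonoid C) : Prop where
  nonempty : w ≠ 1
  runs : RunsAtMost p w
  factors : ∀ u : FreeMonoid C, u.length = n → RunsAtMost p u → IsFactor u w

/-- A word is uniform if all its letters appear in it the same number of times. -/
def IsUniformWord {C : Type*} [DecidableEq C] (w : FreeMonoid C) : Prop :=
  ∃ k : ℕ, ∀ a ∈ w.toList, w.toList.count a = k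

/-! ## The plactic monoid -/

/-- The elementary Knuth relations on words over an ordered alphabet. -/
inductive KnuthRel (A : Type*) [LinearOrder A] : FreeMonoid A → FreeMonoid A → Prop
  | kn1 (a b c : A) (hab : a ≤ b) (hbc : b < c) :
      KnuthRel A (.of a * .of c * .of b) (.of c * .of a * .of b)
  | kn2 (a b c : A) (hab : a < b) (hbc : b ≤ c) :
      KnuthRel A (.of b * .of a * .of c) (.of b * .of c * .of a)

/-- The plactic monoid over the ordered alphabet `A`: the quotient of the free monoid on `A` by the
congruence generated by the elementary Knuth relations. -/
abbrev PlacticMonoid (A : Type*) [LinearOrder A] : Type _ :=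
  PresentedMonoid (KnuthRel A)

/-! ## Triangular tropical matrices -/

/-- The max-plus semiring `ℝ ∪ {-∞}`. Mathlib's `Tropical` has the minimum as its addition, so it is
applied to the reals with the reversed order and a greatest element adjoined, which plays the role of
`-∞`. Thus the addition is the maximum of real numbers, the multiplication is the usual sum, the
zero is `-∞` and the one is the real number `0`. -/
abbrev MaxPlus : Type := Tropical (WithTop ℝᵒᵈ)

/-- The monoid of all upper triangular `n × n` matrices over the max-plus semiring. -/
def TMat (n : ℕ) : Submonoid (Matrix (Fin n) (Fin n) MaxPlus) where
  carrier := {A | ∀ i j, j < i → A i j = 0}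
  one_mem' := fun _ _ h => Matrix.one_apply_ne h.ne'
  mul_mem' := by
    intro A B hA hB i j hij
    rw [Matrix.mul_apply]
    refine Finset.sum_eq_zero fun k _ => ?_
    rcases lt_or_ge k i with hk | hk
    · rw [hA i k hk, zero_mul]
    · rw [hB k j (hij.trans_le hk), mul_zero]

/-! ## Monotone triangular matrices over the integers -/

/-! The plactic monoid of rank three embeds in a direct product of two copies of a subsemigroup of
`TMat 3`, and identities pass to subsemigroups and direct products. One representation measures
longest weakly increasing subwords with letters in an interval, the other pairs of disjoint such
subwords. Schensted insertion brings every element to tableau form (`isTableau`), and six matrix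
entries recover the six parameters of the tableau, as in Greene's theorem, so the pair is faithful
(`eq_of_rowRep_eq_of_pairRep_eq`).

For the concrete identities, `uv` and `vu` have images with equal diagonals. An entry of a product
of such matrices is a maximum over the positions and letters of at most two jumps, with a value
linear in the positions. If every two-letter word occurs in `w`, jumps at the middle letter of `w a
w` can be relocated into a copy of `w` without loss (`HasAllPairs.exists_double`), so the middle
letter is irrelevant. -/

/-- An upper triangular `3 × 3` max-plus matrix with integer entries on and above the diagonal,
which increase along the rows and decrease along the columns. -/
@[ext]
structure MonoTri where
  e11 : ℤ
  e12 : ℤ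
  e13 : ℤ
  e22 : ℤ
  e23 : ℤ
  e33 : ℤ
  h1 : e11 ≤ e12
  h2 : e12 ≤ e13
  h3 : e22 ≤ e12
  h4 : e22 ≤ e23
  h5 : e23 ≤ e13
  h6 : e33 ≤ e23

namespace MonoTri

instance : Mul MonoTri where
  mul A B :=
    { e11 := A.e11 + B.e11
      e12 := max (A.e11 + B.e12) (A.e12 + B.e22)
      e13 := max (A.e11 + B.e13) (max (A.e12 + B.e23) (A.e13 + B.e33))
      e22 := A.e22 + B.e22
      e23 := max (A.e22 + B.e23) (A.e23 + B.e33)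
      e33 := A.e33 + B.e33
      h1 := by have := B.h1; omega
      h2 := by have := B.h2; have := B.h4; omega
      h3 := by have := A.h3; omega
      h4 := by have := B.h4; omega
      h5 := by have := A.h3; have := A.h5; omega
      h6 := by have := A.h6; omega }

/-- Monotonicity makes the triangle of zeros neutral, since the extra terms in each maximum are
dominated. It is not the identity of `TMat 3`, so `toTMat` is only multiplicative. -/
instance : One MonoTri where
  one := ⟨0, 0, 0, 0, 0, 0, le_rfl, le_rfl, le_rfl, le_rfl, le_rfl, le_rfl⟩

@[simp] lemma mul_e11 (A B : MonoTri) : (A * B).e11 = A.e11 + B.e11 := rfl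
@[simp] lemma mul_e12 (A B : MonoTri) :
    (A * B).e12 = max (A.e11 + B.e12) (A.e12 + B.e22) := rfl
@[simp] lemma mul_e13 (A B : MonoTri) :
    (A * B).e13 = max (A.e11 + B.e13) (max (A.e12 + B.e23) (A.e13 + B.e33)) := rfl
@[simp] lemma mul_e22 (A B : MonoTri) : (A * B).e22 = A.e22 + B.e22 := rfl
@[simp] lemma mul_e23 (A B : MonoTri) :
    (A * B).e23 = max (A.e22 + B.e23) (A.e23 + B.e33) := rfl
@[simp] lemma mul_e33 (A B : MonoTri) : (A * B).e33 = A.e33 + B.e33 := rfl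
@[simp] lemma one_e11 : (1 : MonoTri).e11 = 0 := rfl
@[simp] lemma one_e12 : (1 : MonoTri).e12 = 0 := rfl
@[simp] lemma one_e13 : (1 : MonoTri).e13 = 0 := rfl
@[simp] lemma one_e22 : (1 : MonoTri).e22 = 0 := rfl
@[simp] lemma one_e23 : (1 : MonoTri).e23 = 0 := rfl
@[simp] lemma one_e33 : (1 : MonoTri).e33 = 0 := rfl

instance : Monoid MonoTri where
  mul_assoc A B C := by ext <;> simp <;> omega
  one_mul A := by
    obtain ⟨_, _, _, _, _, _, _, _, _, _, _, _⟩ := A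
    ext <;> simp <;> omega
  mul_one A := by
    obtain ⟨_, _, _, _, _, _, _, _, _, _, _, _⟩ := A
    ext <;> simp <;> omega

/-- An integer as an element of the max-plus semiring. -/
def ofInt (z : ℤ) : MaxPlus := Tropical.trop ((OrderDual.toDual (z : ℝ) : ℝᵒᵈ) : WithTop ℝᵒᵈ)

lemma ofInt_injective : Function.Injective ofInt := by
  intro a b h
  have h1 := WithTop.coe_injective (Tropical.trop_injective h)
  exact_mod_cast OrderDual.toDual.injective h1

lemma ofInt_add (a b : ℤ) : ofInt (a + b) = ofInt a * ofInt b := by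
  unfold ofInt
  rw [← Tropical.trop_add, ← WithTop.coe_add, ← toDual_add, Int.cast_add]

lemma ofInt_max (a b : ℤ) : ofInt (max a b) = ofInt a + ofInt b := by
  rcases le_total a b with h | h
  · rw [max_eq_right h, Tropical.add_eq_right]
    exact WithTop.coe_le_coe.2 (OrderDual.toDual_le_toDual.2 (Int.cast_le.2 h))
  · rw [max_eq_left h, Tropical.add_eq_left]
    exact WithTop.coe_le_coe.2 (OrderDual.toDual_le_toDual.2 (Int.cast_le.2 h))

/-- The max-plus matrix of a monotone triangular matrix. -/
def toMatrix (A : MonoTri) : Matrix (Fin 3) (Fin 3) MaxPlus :=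
  !![ofInt A.e11, ofInt A.e12, ofInt A.e13; 0, ofInt A.e22, ofInt A.e23; 0, 0, ofInt A.e33]

lemma toMatrix_mul (A B : MonoTri) : toMatrix (A * B) = toMatrix A * toMatrix B := by
  ext i j
  fin_cases i <;> fin_cases j <;>
    simp [toMatrix, Matrix.mul_apply, Fin.sum_univ_three, ofInt_add, ofInt_max, add_assoc]

/-- Monotone triangular matrices form a subsemigroup of the triangular max-plus matrices. -/
def toTMat : MonoTri →ₙ* TMat 3 where
  toFun A := ⟨toMatrix A, by
    intro i j h
    fin_cases i <;> fin_cases j <;> first | rfl | (exact absurd h (by decide))⟩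
  map_mul' A B := Subtype.ext (toMatrix_mul A B)

lemma toTMat_injective : Function.Injective toTMat := by
  intro A B h
  have h' : toMatrix A = toMatrix B := congrArg Subtype.val h
  have key (i j : Fin 3) : toMatrix A i j = toMatrix B i j := by rw [h']
  ext
  · exact ofInt_injective (key 0 0)
  · exact ofInt_injective (key 0 1)
  · exact ofInt_injective (key 0 2)
  · exact ofInt_injective (key 1 1)
  · exact ofInt_injective (key 1 2)
  · exact ofInt_injective (key 2 2)

end MonoTri

/-! ## Two representations of the plactic monoid of rank three -/

/-- The matrix of a letter, recording weakly increasing subwords: the entry `(i, j)` is `1` if the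
letter lies between `i` and `j`. -/
def rowLetter : Fin 3 → MonoTri :=
  ![⟨1, 1, 1, 0, 0, 0, by simp, by simp, by simp, by simp, by simp, by simp⟩,
    ⟨0, 1, 1, 1, 1, 0, by simp, by simp, by simp, by simp, by simp, by simp⟩,
    ⟨0, 0, 1, 0, 1, 1, by simp, by simp, by simp, by simp, by simp, by simp⟩]

/-- The matrix of a letter, recording pairs of disjoint weakly increasing subwords: the rows and
columns are indexed by the two-element sets of letters, and an entry is `1` if the letter belongs
to a set between the two indices. -/
def pairLetter : Fin 3 → MonoTri :=
  ![⟨1, 1, 1, 1, 1, 0, by simp, by simp, by simp, by simp, by simp, by simp⟩,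
    ⟨1, 1, 1, 0, 1, 1, by simp, by simp, by simp, by simp, by simp, by simp⟩,
    ⟨0, 1, 1, 1, 1, 1, by simp, by simp, by simp, by simp, by simp, by simp⟩]

lemma rowLetter_knuth (u v : FreeMonoid (Fin 3)) (h : KnuthRel (Fin 3) u v) :
    FreeMonoid.lift rowLetter u = FreeMonoid.lift rowLetter v := by
  rcases h with ⟨a, b, c, hab, hbc⟩ | ⟨a, b, c, hab, hbc⟩ <;>
    fin_cases a <;> fin_cases b <;> fin_cases c <;>
    first
    | exact absurd hab (by decide)
    | exact absurd hbc (by decide)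
    | (ext <;> simp [rowLetter])

lemma pairLetter_knuth (u v : FreeMonoid (Fin 3)) (h : KnuthRel (Fin 3) u v) :
    FreeMonoid.lift pairLetter u = FreeMonoid.lift pairLetter v := by
  rcases h with ⟨a, b, c, hab, hbc⟩ | ⟨a, b, c, hab, hbc⟩ <;>
    fin_cases a <;> fin_cases b <;> fin_cases c <;>
    first
    | exact absurd hab (by decide)
    | exact absurd hbc (by decide)
    | (ext <;> simp [pairLetter])

/-- The representation of the plactic monoid by weakly increasing subwords. -/
def rowRep : PlacticMonoid (Fin 3) →* MonoTri :=
  PresentedMonoid.lift rowLetter rowLetter_knuth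

/-- The representation of the plactic monoid by pairs of weakly increasing subwords. -/
def pairRep : PlacticMonoid (Fin 3) →* MonoTri :=
  PresentedMonoid.lift pairLetter pairLetter_knuth

/-! ## Normal forms in the plactic monoid of rank three -/

section KnuthMoves

variable {A : Type*} [LinearOrder A]

/-- The class of a letter in the plactic monoid. -/
abbrev letter (a : A) : PlacticMonoid A := PresentedMonoid.of (KnuthRel A) a

lemma letter_kn1 {a b c : A} (hab : a ≤ b) (hbc : b < c) :
    letter a * letter c * letter b = letter c * letter a * letter b :=
  PresentedMonoid.mk_eq_mk_of_rel (KnuthRel.kn1 a b c hab hbc)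

lemma letter_kn2 {a b c : A} (hab : a < b) (hbc : b ≤ c) :
    letter b * letter a * letter c = letter b * letter c * letter a :=
  PresentedMonoid.mk_eq_mk_of_rel (KnuthRel.kn2 a b c hab hbc)

/-- The letter `c` moves left past one `a` at a time; the letter to the right that the Knuth
relation requires is another `a`, or `b` at the end of the block. -/
lemma letter_pow_mul_kn1 {a b c : A} (hab : a ≤ b) (hbc : b < c) (n : ℕ) :
    letter a ^ n * (letter c * letter b) = letter c * (letter a ^ n * letter b) := by
  induction n with
  | zero => simp
  | succ n ih =>
    have hc : letter a * (letter c * letter a ^ n * letter b)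
        = letter c * letter a * letter a ^ n * letter b := by
      rcases n with _ | n
      · simpa [mul_assoc] using letter_kn1 hab hbc
      · rw [pow_succ']
        simp only [← mul_assoc]
        rw [letter_kn1 le_rfl (hab.trans_lt hbc)]
    rw [pow_succ', mul_assoc, ih, ← mul_assoc (letter c), hc]
    simp only [mul_assoc]

/-- Dual to `letter_pow_mul_kn1`: each exchange of `c` and `a` uses the letter to the left, a
further `c` or the initial `b`. -/
lemma letter_mul_pow_kn2 {a b c : A} (hab : a < b) (hbc : b ≤ c) (n : ℕ) :
    letter b * (letter c ^ n * letter a) = letter b * (letter a * letter c ^ n) := by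
  induction n with
  | zero => simp
  | succ n ih =>
    have h : letter b * letter c ^ n * (letter c * letter a) =
        letter b * letter c ^ n * (letter a * letter c) := by
      rcases n with _ | n
      · simpa [mul_assoc] using (letter_kn2 hab hbc).symm
      · have := letter_kn2 (hab.trans_le hbc) (le_refl c)
        rw [pow_succ]
        calc _ = letter b * letter c ^ n * (letter c * letter c * letter a) := by
              simp only [mul_assoc]
          _ = _ := by rw [← this]; simp only [mul_assoc]
    calc _ = letter b * letter c ^ n * (letter c * letter a) := by
          rw [pow_succ]; simp only [mul_assoc]
      _ = letter b * (letter c ^ n * letter a) * letter c := by rw [h]; simp only [mul_assoc]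
      _ = _ := by rw [ih, pow_succ]; simp only [mul_assoc]

/-- Row insertion of `b` into a row `a ⋯ a b ⋯ b c ⋯ c` with at least one `c`. -/
lemma row_insert_last {a b c : A} (hab : a < b) (hbc : b < c) (i j k : ℕ) :
    letter a ^ i * letter b ^ j * letter c ^ (k + 1) * letter b =
      letter c * (letter a ^ i * letter b ^ (j + 1) * letter c ^ k) := by
  -- The inserted `b` stops just after the first `c`; this bumped `c` then travels left through the
  -- whole row.
  have h1 : letter c ^ (k + 1) * letter b = letter c * letter b * letter c ^ k := by
    rw [pow_succ', mul_assoc, letter_mul_pow_kn2 hbc le_rfl, mul_assoc]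
  have h2 := letter_pow_mul_kn1 (le_refl b) hbc j
  have h3 : letter a ^ i * (letter c * letter b ^ (j + 1)) =
      letter c * (letter a ^ i * letter b ^ (j + 1)) := by
    rw [pow_succ', ← mul_assoc (letter c), ← mul_assoc, letter_pow_mul_kn1 hab.le hbc]
    simp only [mul_assoc]
  calc _ = letter a ^ i * (letter b ^ j * (letter c ^ (k + 1) * letter b)) := by
        simp only [mul_assoc]
    _ = letter a ^ i * (letter b ^ j * (letter c * letter b)) * letter c ^ k := by
        rw [h1]; simp only [mul_assoc]
    _ = letter a ^ i * (letter c * letter b ^ (j + 1)) * letter c ^ k := by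
        rw [h2, pow_succ]
    _ = _ := by rw [h3]; simp only [mul_assoc]

/-- Row insertion of `a` into a row `a ⋯ a b ⋯ b c ⋯ c` with at least one `b`. -/
lemma row_insert_mid {a b c : A} (hab : a < b) (hbc : b ≤ c) (i j k : ℕ) :
    letter a ^ i * letter b ^ (j + 1) * letter c ^ k * letter a =
      letter b * (letter a ^ (i + 1) * letter b ^ j * letter c ^ k) := by
  have h1 := letter_mul_pow_kn2 hab hbc k
  have h2 := letter_mul_pow_kn2 hab (le_refl b) j
  have h3 := letter_pow_mul_kn1 (le_refl a) hab i
  calc _ = letter a ^ i * letter b ^ j * (letter b * (letter c ^ k * letter a)) := by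
        simp only [mul_assoc, pow_succ]
    _ = letter a ^ i * (letter b ^ (j + 1) * letter a) * letter c ^ k := by
        rw [h1]; simp only [mul_assoc, pow_succ]
    _ = letter a ^ i * (letter b * letter a) * letter b ^ j * letter c ^ k := by
        rw [pow_succ', mul_assoc (letter b), h2]; simp only [mul_assoc]
    _ = _ := by rw [h3, pow_succ]; simp only [mul_assoc]

end KnuthMoves

/-- The element of the plactic monoid of rank three whose tableau has the first row
`1^a₁ 2^a₂ 3^a₃`, the second row `2^b₂ 3^b₃` and the third row `3^c`. -/
def tableau (a₁ a₂ a₃ b₂ b₃ c : ℕ) : PlacticMonoid (Fin 3) :=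
  letter 2 ^ c * (letter 1 ^ b₂ * letter 2 ^ b₃) * (letter 0 ^ a₁ * letter 1 ^ a₂ * letter 2 ^ a₃)

/-- The elements of the plactic monoid that are given by semistandard tableaux. -/
def IsTableau (x : PlacticMonoid (Fin 3)) : Prop :=
  ∃ a₁ a₂ a₃ b₂ b₃ c : ℕ, c ≤ b₂ ∧ b₂ ≤ a₁ ∧ b₂ + b₃ ≤ a₁ + a₂ ∧ x = tableau a₁ a₂ a₃ b₂ b₃ c

/-- Schensted insertion: a letter bumped from one row is inserted into the next. The cases ask which
larger letters are present to be bumped. -/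
lemma IsTableau.mul_letter {x : PlacticMonoid (Fin 3)} (hx : IsTableau x) (s : Fin 3) :
    IsTableau (x * letter s) := by
  obtain ⟨a₁, a₂, a₃, b₂, b₃, c, h1, h2, h3, rfl⟩ := hx
  have h01 : (0 : Fin 3) < 1 := by decide
  have h12 : (1 : Fin 3) < 2 := by decide
  obtain rfl | rfl | rfl : s = 0 ∨ s = 1 ∨ s = 2 := by fin_cases s <;> simp
  · rcases a₂ with _ | a₂
    · rcases a₃ with _ | a₃
      · refine ⟨a₁ + 1, 0, 0, b₂, b₃, c, h1, by omega, by omega, ?_⟩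
        simp [tableau, pow_succ, mul_assoc]
      -- With no 2 in the first row, the inserted 1 bumps a 3, which goes to the end of the second
      -- row.
      · refine ⟨a₁ + 1, 0, a₃, b₂, b₃ + 1, c, h1, by omega, by omega, ?_⟩
        have := row_insert_mid (h01.trans h12) (le_refl (2 : Fin 3)) a₁ a₃ 0
        simp only [pow_zero, mul_one] at this
        simp only [tableau, pow_zero, mul_one]
        rw [mul_assoc, this, pow_succ _ b₃]
        simp only [mul_assoc]
    · have h := row_insert_mid h01 h12.le a₁ a₂ a₃
      rcases b₃ with _ | b₃
      · refine ⟨a₁ + 1, a₂, a₃, b₂ + 1, 0, c, by omega, by omega, by omega, ?_⟩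
        simp only [tableau, pow_zero, mul_one]
        rw [mul_assoc, h, pow_succ _ b₂]
        simp only [mul_assoc]
      · refine ⟨a₁ + 1, a₂, a₃, b₂ + 1, b₃, c + 1, by omega, by omega, by omega, ?_⟩
        -- The bumped 2 bumps a 3 into the third row. The exponent `0` reflects that the second row
        -- has no 1.
        have h' := row_insert_last h01 h12 0 b₂ b₃
        simp only [pow_zero, one_mul] at h'
        rw [tableau, mul_assoc, h, tableau, pow_succ _ c, mul_assoc _ (letter 2) (_ * _), ← h']
        simp only [mul_assoc]
  · rcases a₃ with _ | a₃
    · refine ⟨a₁, a₂ + 1, 0, b₂, b₃, c, h1, h2, by omega, ?_⟩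
      simp [tableau, pow_succ, mul_assoc]
    · refine ⟨a₁, a₂ + 1, a₃, b₂, b₃ + 1, c, h1, h2, by omega, ?_⟩
      rw [tableau, mul_assoc, row_insert_last h01 h12, tableau, pow_succ _ b₃]
      simp only [mul_assoc]
  · refine ⟨a₁, a₂, a₃ + 1, b₂, b₃, c, h1, h2, h3, ?_⟩
    simp [tableau, pow_succ, mul_assoc]

lemma isTableau (x : PlacticMonoid (Fin 3)) : IsTableau x := by
  obtain ⟨w, rfl⟩ := PresentedMonoid.surjective_mk x
  induction w using List.reverseRecOn with
  | nil => exact ⟨0, 0, 0, 0, 0, 0, le_rfl, le_rfl, le_rfl, by simp [tableau]; rfl⟩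
  | append_singleton l s ih => exact ih.mul_letter s

lemma rowRep_letter (s : Fin 3) : rowRep (letter s) = rowLetter s := by
  simp [rowRep, letter]

lemma pairRep_letter (s : Fin 3) : pairRep (letter s) = pairLetter s := by
  simp [pairRep, letter]

lemma rowLetter_pow (s : Fin 3) (n : ℕ) :
    (rowLetter s ^ n).e11 = n * (rowLetter s).e11 ∧ (rowLetter s ^ n).e12 = n * (rowLetter s).e12 ∧
    (rowLetter s ^ n).e13 = n * (rowLetter s).e13 ∧ (rowLetter s ^ n).e22 = n * (rowLetter s).e22 ∧
    (rowLetter s ^ n).e23 = n * (rowLetter s).e23 ∧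
    (rowLetter s ^ n).e33 = n * (rowLetter s).e33 := by
  induction n with
  | zero => simp
  | succ n ih =>
    obtain ⟨i1, i2, i3, i4, i5, i6⟩ := ih
    simp only [pow_succ, MonoTri.mul_e11, MonoTri.mul_e12, MonoTri.mul_e13, MonoTri.mul_e22,
      MonoTri.mul_e23, MonoTri.mul_e33, i1, i2, i3, i4, i5, i6]
    fin_cases s <;> simp [rowLetter]

lemma pairLetter_pow (s : Fin 3) (n : ℕ) :
    (pairLetter s ^ n).e11 = n * (pairLetter s).e11 ∧
    (pairLetter s ^ n).e12 = n * (pairLetter s).e12 ∧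
    (pairLetter s ^ n).e13 = n * (pairLetter s).e13 ∧
    (pairLetter s ^ n).e22 = n * (pairLetter s).e22 ∧
    (pairLetter s ^ n).e23 = n * (pairLetter s).e23 ∧
    (pairLetter s ^ n).e33 = n * (pairLetter s).e33 := by
  induction n with
  | zero => simp
  | succ n ih =>
    obtain ⟨i1, i2, i3, i4, i5, i6⟩ := ih
    simp only [pow_succ, MonoTri.mul_e11, MonoTri.mul_e12, MonoTri.mul_e13, MonoTri.mul_e22,
      MonoTri.mul_e23, MonoTri.mul_e33, i1, i2, i3, i4, i5, i6]
    fin_cases s <;> simp [pairLetter]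

/-! ### Reading the tableau parameters off the matrices -/

section Invariants

variable {a₁ a₂ a₃ b₂ b₃ c : ℕ}

/-- The column inequalities ensure that the maxima `e12` and `e13` are attained on the first row;
`e11` and `e33` count the letters 1 and 3. -/
lemma rowRep_tableau (h1 : c ≤ b₂) (h2 : b₂ ≤ a₁) (h3 : b₂ + b₃ ≤ a₁ + a₂) :
    (rowRep (tableau a₁ a₂ a₃ b₂ b₃ c)).e11 = a₁ ∧
    (rowRep (tableau a₁ a₂ a₃ b₂ b₃ c)).e12 = a₁ + a₂ ∧
    (rowRep (tableau a₁ a₂ a₃ b₂ b₃ c)).e13 = a₁ + a₂ + a₃ ∧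
    (rowRep (tableau a₁ a₂ a₃ b₂ b₃ c)).e33 = a₃ + b₃ + c := by
  simp only [tableau, map_mul, map_pow, rowRep_letter, MonoTri.mul_e11, MonoTri.mul_e12,
    MonoTri.mul_e13, MonoTri.mul_e22, MonoTri.mul_e23, MonoTri.mul_e33, rowLetter_pow]
  simp [rowLetter]
  omega

/-- The entry `e11` counts the letters 1 and 2, and `e13` is the total length of the first two rows,
as in Greene's theorem. -/
lemma pairRep_tableau (h1 : c ≤ b₂) (h2 : b₂ ≤ a₁) :
    (pairRep (tableau a₁ a₂ a₃ b₂ b₃ c)).e11 = a₁ + a₂ + b₂ ∧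
    (pairRep (tableau a₁ a₂ a₃ b₂ b₃ c)).e13 = a₁ + a₂ + a₃ + b₂ + b₃ := by
  simp only [tableau, map_mul, map_pow, pairRep_letter, MonoTri.mul_e11, MonoTri.mul_e12,
    MonoTri.mul_e13, MonoTri.mul_e22, MonoTri.mul_e23, MonoTri.mul_e33, pairLetter_pow]
  simp [pairLetter]
  omega

end Invariants

/-- The two representations together separate the elements of the plactic monoid of rank three. -/
lemma eq_of_rowRep_eq_of_pairRep_eq {x y : PlacticMonoid (Fin 3)} (hrow : rowRep x = rowRep y)
    (hpair : pairRep x = pairRep y) : x = y := by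
  obtain ⟨a₁, a₂, a₃, b₂, b₃, c, h1, h2, h3, rfl⟩ := isTableau x
  obtain ⟨a₁', a₂', a₃', b₂', b₃', c', h1', h2', h3', rfl⟩ := isTableau y
  obtain ⟨i1, i2, i3, i4⟩ := rowRep_tableau (a₃ := a₃) h1 h2 h3
  obtain ⟨i1', i2', i3', i4'⟩ := rowRep_tableau (a₃ := a₃') h1' h2' h3'
  obtain ⟨j1, j2⟩ := pairRep_tableau (a₂ := a₂) (a₃ := a₃) (b₃ := b₃) h1 h2
  obtain ⟨j1', j2'⟩ := pairRep_tableau (a₂ := a₂') (a₃ := a₃') (b₃ := b₃') h1' h2'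
  rw [hrow] at i1 i2 i3 i4
  rw [hpair] at j1 j2
  -- The system is triangular: `rowRep` gives the first row, `pairRep` then gives `b₂` and `b₃`, and
  -- the number of 3s gives `c`.
  obtain rfl : a₁ = a₁' := by omega
  obtain rfl : a₂ = a₂' := by omega
  obtain rfl : a₃ = a₃' := by omega
  obtain rfl : b₂ = b₂' := by omega
  obtain rfl : b₃ = b₃' := by omega
  obtain rfl : c = c' := by omega
  rfl

lemma satisfiesIdentity_plactic {α : Type*} {u v : FreeSemigroup α}
    (h : SatisfiesIdentity (TMat 3) u v) : SatisfiesIdentity (PlacticMonoid (Fin 3)) u v := by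
  intro φ
  apply eq_of_rowRep_eq_of_pairRep_eq
  · exact MonoTri.toTMat_injective
      (h (MonoTri.toTMat.comp ((rowRep : PlacticMonoid (Fin 3) →ₙ* MonoTri).comp φ)))
  · exact MonoTri.toTMat_injective
      (h (MonoTri.toTMat.comp ((pairRep : PlacticMonoid (Fin 3) →ₙ* MonoTri).comp φ)))

/-! ## Products of matrices with a common diagonal -/

/-- Every word of length two is a factor of `w`. -/
def HasAllPairs {ι : Type*} (w : List ι) : Prop :=
  ∀ s t : ι, ∃ k, w[k]? = some s ∧ w[k + 1]? = some t

/-! ### Moving jumps away from the middle letter -/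

section Jumps

variable {ι : Type*}

/-- Only a jump at the middle has to move; its letter occurs in both copies of `w`, and the sign of
`α` selects the copy. -/
lemma HasAllPairs.exists_single {w : List ι} (hw : HasAllPairs w) (a b : ι) (α : ℤ) {i : ℕ} {s : ι}
    (hi : (w ++ a :: w)[i]? = some s) :
    ∃ i' : ℕ, (w ++ b :: w)[i']? = some s ∧ α * i ≤ α * i' := by
  have hfst {k : ℕ} {t : ι} (h : w[k]? = some t) : k < w.length ∧ (w ++ b :: w)[k]? = some t := by
    have hk := (List.getElem?_eq_some_iff.1 h).1
    exact ⟨hk, by rw [List.getElem?_append_left hk, h]⟩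
  have hsnd {k : ℕ} {t : ι} (h : w[k]? = some t) :
      (w ++ b :: w)[w.length + 1 + k]? = some t := by
    rw [List.getElem?_append_right (by omega),
      show w.length + 1 + k - w.length = k + 1 by omega, List.getElem?_cons_succ, h]
  by_cases hm : i = w.length
  · obtain ⟨k, hk, -⟩ := hw s s
    rcases le_total 0 α with hα | hα
    · exact ⟨_, hsnd hk, mul_le_mul_of_nonneg_left (by omega) hα⟩
    · have := hfst hk
      exact ⟨_, this.2, mul_le_mul_of_nonpos_left (by omega) hα⟩
  · refine ⟨i, ?_, le_rfl⟩
    rcases lt_or_gt_of_ne hm with h | h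
    · rwa [List.getElem?_append_left h] at hi ⊢
    · rw [List.getElem?_append_right h.le] at hi ⊢
      rwa [show i - w.length = i - w.length - 1 + 1 by omega, List.getElem?_cons_succ] at hi ⊢

/-- If one of the jumps is at the middle, the signs of `α` and `β` say in which direction each jump
gains. An occurrence of `st` in a copy of `w` provides targets in the right order. -/
lemma HasAllPairs.exists_double {w : List ι} (hw : HasAllPairs w) (a b : ι) (α β : ℤ) {i j : ℕ}
    {s t : ι} (hij : i < j) (hi : (w ++ a :: w)[i]? = some s)
    (hj : (w ++ a :: w)[j]? = some t) :
    ∃ i' j' : ℕ, i' < j' ∧ (w ++ b :: w)[i']? = some s ∧ (w ++ b :: w)[j']? = some t ∧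
      α * i + β * j ≤ α * i' + β * j' := by
  have hfst {k : ℕ} {t : ι} (h : w[k]? = some t) : k < w.length ∧ (w ++ b :: w)[k]? = some t := by
    have hk := (List.getElem?_eq_some_iff.1 h).1
    exact ⟨hk, by rw [List.getElem?_append_left hk, h]⟩
  have hsnd {k : ℕ} {t : ι} (h : w[k]? = some t) :
      (w ++ b :: w)[w.length + 1 + k]? = some t := by
    rw [List.getElem?_append_right (by omega),
      show w.length + 1 + k - w.length = k + 1 by omega, List.getElem?_cons_succ, h]
  have hne {k : ℕ} {t : ι} (hm : k ≠ w.length) (h : (w ++ a :: w)[k]? = some t) :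
      (w ++ b :: w)[k]? = some t := by
    rcases lt_or_gt_of_ne hm with h' | h'
    · rwa [List.getElem?_append_left h'] at h ⊢
    · rw [List.getElem?_append_right h'.le] at h ⊢
      rwa [show k - w.length = k - w.length - 1 + 1 by omega, List.getElem?_cons_succ] at h ⊢
  by_cases hm : i ≠ w.length ∧ j ≠ w.length
  · exact ⟨i, j, hij, hne hm.1 hi, hne hm.2 hj, le_rfl⟩
  obtain ⟨k, hks, hkt⟩ := hw s t
  have hk := (hfst hkt).1
  have hs1 := (hfst hks).2
  have ht1 := (hfst hkt).2
  have hs2 := hsnd hks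
  have ht2 := hsnd hkt
  have mono {i' j' : ℕ} (h1 : 0 ≤ α * ((i' : ℤ) - i)) (h2 : 0 ≤ β * ((j' : ℤ) - j)) :
      α * i + β * j ≤ α * i' + β * j' := by linarith
  -- When the jumps attract each other, making them adjacent loses nothing; the adjacent pair then
  -- slides in the direction given by the sign of `α + β`.
  have adj (n : ℕ) (hα : 0 ≤ α) (hβ : β ≤ 0)
      (h : 0 ≤ α + β ∧ i ≤ n ∨ α + β ≤ 0 ∧ n + 1 ≤ j) :
      α * i + β * j ≤ α * n + β * ((n + 1 : ℕ) : ℤ) := by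
    have hβ' : 0 ≤ -β := by linarith
    push_cast
    rcases h with ⟨h, hn⟩ | ⟨h, hn⟩
    · have e1 : 0 ≤ (α + β) * ((n : ℤ) - i) := mul_nonneg h (by omega)
      have e2 : 0 ≤ -β * ((j : ℤ) - i - 1) := mul_nonneg hβ' (by omega)
      linarith
    · have e1 : 0 ≤ -(α + β) * ((j : ℤ) - 1 - n) := mul_nonneg (by linarith) (by omega)
      have e2 : 0 ≤ α * ((j : ℤ) - i - 1) := mul_nonneg hα (by omega)
      linarith
  rcases le_total 0 α with hα | hα <;> rcases le_total 0 β with hβ | hβ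
  -- Both jumps gain to the right; the second stays if it is already beyond the target pair.
  · by_cases hjk : w.length + 1 + (k + 1) ≤ j
    · exact ⟨w.length + 1 + k, j, by omega, hs2, hne (by omega) hj,
        mono (mul_nonneg hα (by omega)) (by simp)⟩
    · exact ⟨w.length + 1 + k, w.length + 1 + (k + 1), by omega, hs2, ht2,
        mono (mul_nonneg hα (by omega)) (mul_nonneg hβ (by omega))⟩
  · rcases le_total 0 (α + β) with h | h
    · exact ⟨w.length + 1 + k, w.length + 1 + (k + 1), by omega, hs2, ht2,
        adj _ hα hβ (Or.inl ⟨h, by omega⟩)⟩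
    · exact ⟨k, k + 1, by omega, hs1, ht1, adj _ hα hβ (Or.inr ⟨h, by omega⟩)⟩
  -- The jumps repel: the first stays in or moves to the left copy, the second the right copy, so
  -- their order is automatic.
  · obtain ⟨i', hi1, hi2, hi3⟩ : ∃ i', (w ++ b :: w)[i']? = some s ∧ i' ≤ i ∧ i' < w.length := by
      by_cases h : i = w.length
      · exact ⟨k, hs1, by omega, by omega⟩
      · exact ⟨i, hne h hi, le_rfl, by omega⟩
    obtain ⟨j', hj1, hj2, hj3⟩ : ∃ j', (w ++ b :: w)[j']? = some t ∧ j ≤ j' ∧ w.length < j' := by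
      by_cases h : j = w.length
      · exact ⟨w.length + 1 + (k + 1), ht2, by omega, by omega⟩
      · exact ⟨j, hne h hj, le_rfl, by omega⟩
    exact ⟨i', j', by omega, hi1, hj1,
      mono (mul_nonneg_of_nonpos_of_nonpos hα (by omega)) (mul_nonneg hβ (by omega))⟩
  · by_cases hik : i ≤ k
    · exact ⟨i, k + 1, by omega, hne (by omega) hi, ht1,
        mono (by simp) (mul_nonneg_of_nonpos_of_nonpos hβ (by omega))⟩
    · exact ⟨k, k + 1, by omega, hs1, ht1,
        mono (mul_nonneg_of_nonpos_of_nonpos hα (by omega))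
          (mul_nonneg_of_nonpos_of_nonpos hβ (by omega))⟩

end Jumps

/-! ### Maxima over the position of one jump -/

section SingleJump

variable {ι : Type*} {g : List ι → ℤ} {v : ι → ℤ} {p q : ℤ}

/-- The zero-based `i` counts the letters before the jump, each contributing `p`; those after it
contribute `q`. Only inequalities are assumed, so that this also covers direct jumps in `e13`. -/
lemma single_jump_le (h1 : ∀ s l, p + g l ≤ g (s :: l))
    (h2 : ∀ s l, v s + (l.length : ℤ) * q ≤ g (s :: l)) {l : List ι} {i : ℕ} {s : ι}
    (hi : l[i]? = some s) : i * p + v s + ((l.length : ℤ) - 1 - i) * q ≤ g l := by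
  induction l generalizing i with
  | nil => simp at hi
  | cons t l ih =>
    rcases i with _ | i
    · obtain rfl : t = s := by simpa using hi
      simpa using h2 t l
    · have := ih (by simpa using hi)
      have := h1 t l
      push_cast [List.length_cons]
      linarith

lemma exists_single_jump_eq (h0 : ∀ s, g [s] = v s)
    (h1 : ∀ s l, g (s :: l) = max (p + g l) (v s + (l.length : ℤ) * q)) {l : List ι}
    (hl : l ≠ []) :
    ∃ (i : ℕ) (s : ι), l[i]? = some s ∧ g l = i * p + v s + ((l.length : ℤ) - 1 - i) * q := by
  induction l with
  | nil => exact absurd rfl hl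
  | cons t l ih =>
    rcases eq_or_ne l [] with rfl | hl'
    · exact ⟨0, t, rfl, by simp [h0]⟩
    · rcases le_total (v t + (l.length : ℤ) * q) (p + g l) with h | h
      · obtain ⟨i, s, hi, he⟩ := ih hl'
        refine ⟨i + 1, s, by simpa using hi, ?_⟩
        rw [h1, max_eq_left h, he]
        push_cast [List.length_cons]
        ring
      · exact ⟨0, t, rfl, by rw [h1, max_eq_right h]; simp⟩

lemma HasAllPairs.single_jump_mono {w : List ι} (hw : HasAllPairs w) (a b : ι)
    (h0 : ∀ s, g [s] = v s)
    (h1 : ∀ s l, g (s :: l) = max (p + g l) (v s + (l.length : ℤ) * q)) :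
    g (w ++ a :: w) ≤ g (w ++ b :: w) := by
  obtain ⟨i, s, hi, he⟩ := exists_single_jump_eq h0 h1 (l := w ++ a :: w) (by simp)
  obtain ⟨i', hi', hle⟩ := hw.exists_single a b (p - q) hi
  have := single_jump_le (g := g) (v := v) (p := p) (q := q)
    (fun s l => by rw [h1]; exact le_max_left _ _)
    (fun s l => by rw [h1]; exact le_max_right _ _) hi'
  simp only [List.length_append, List.length_cons] at this he
  linarith

end SingleJump

/-! ### Entries of products as maxima over jumps -/

section Products

variable {ι : Type*} {f : ι → MonoTri} {p q r : ℤ}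

lemma prod_e11 (hp : ∀ s, (f s).e11 = p) (l : List ι) : (l.map f).prod.e11 = l.length * p := by
  induction l with
  | nil => simp
  | cons t l ih => simp [ih, hp]; ring

lemma prod_e22 (hq : ∀ s, (f s).e22 = q) (l : List ι) : (l.map f).prod.e22 = l.length * q := by
  induction l with
  | nil => simp
  | cons t l ih => simp [ih, hq]; ring

lemma prod_e33 (hr : ∀ s, (f s).e33 = r) (l : List ι) : (l.map f).prod.e33 = l.length * r := by
  induction l with
  | nil => simp
  | cons t l ih => simp [ih, hr]; ring

lemma prod_e12_cons (hp : ∀ s, (f s).e11 = p) (hq : ∀ s, (f s).e22 = q) (s : ι) (l : List ι) :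
    ((s :: l).map f).prod.e12 =
      max (p + (l.map f).prod.e12) ((f s).e12 + (l.length : ℤ) * q) := by
  simp [hp, prod_e22 hq]

lemma prod_e23_cons (hq : ∀ s, (f s).e22 = q) (hr : ∀ s, (f s).e33 = r) (s : ι) (l : List ι) :
    ((s :: l).map f).prod.e23 =
      max (q + (l.map f).prod.e23) ((f s).e23 + (l.length : ℤ) * r) := by
  simp [hq, prod_e33 hr]

lemma prod_e13_cons (hp : ∀ s, (f s).e11 = p) (hr : ∀ s, (f s).e33 = r) (s : ι) (l : List ι) :
    ((s :: l).map f).prod.e13 =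
      max (p + (l.map f).prod.e13)
        (max ((f s).e12 + (l.map f).prod.e23) ((f s).e13 + (l.length : ℤ) * r)) := by
  simp [hp, prod_e33 hr]

lemma double_jump_le (hp : ∀ s, (f s).e11 = p) (hq : ∀ s, (f s).e22 = q)
    (hr : ∀ s, (f s).e33 = r) {l : List ι} {i j : ℕ} {s t : ι} (hij : i < j)
    (hi : l[i]? = some s) (hj : l[j]? = some t) :
    i * p + (f s).e12 + ((j : ℤ) - i - 1) * q + (f t).e23 + ((l.length : ℤ) - 1 - j) * r ≤
      (l.map f).prod.e13 := by
  induction l generalizing i j with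
  | nil => simp at hi
  | cons c l ih =>
    rw [prod_e13_cons hp hr]
    obtain ⟨j, rfl⟩ : ∃ k, j = k + 1 := ⟨j - 1, by omega⟩
    rw [List.getElem?_cons_succ] at hj
    push_cast [List.length_cons]
    rcases i with _ | i
    · obtain rfl : c = s := by simpa using hi
      refine le_trans ?_ ((le_max_left _ _).trans (le_max_right _ _))
      have := single_jump_le (g := fun l => (l.map f).prod.e23) (v := fun s => (f s).e23)
        (p := q) (q := r)
        (fun s l => by simp only [prod_e23_cons hq hr]; exact le_max_left _ _)
        (fun s l => by simp only [prod_e23_cons hq hr]; exact le_max_right _ _) hj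
      push_cast
      linarith
    · rw [List.getElem?_cons_succ] at hi
      refine le_trans ?_ (le_max_left _ _)
      have := ih (by omega) hi hj
      push_cast
      linarith

/-- An optimal path from index 1 to index 3 either jumps directly or stops at index 2 between two
jumps. -/
lemma exists_jump_eq (hp : ∀ s, (f s).e11 = p) (hq : ∀ s, (f s).e22 = q)
    (hr : ∀ s, (f s).e33 = r) {l : List ι} (hl : l ≠ []) :
    (∃ (i : ℕ) (s : ι), l[i]? = some s ∧
      (l.map f).prod.e13 = i * p + (f s).e13 + ((l.length : ℤ) - 1 - i) * r) ∨
    ∃ (i j : ℕ) (s t : ι), i < j ∧ l[i]? = some s ∧ l[j]? = some t ∧ (l.map f).prod.e13 =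
      i * p + (f s).e12 + ((j : ℤ) - i - 1) * q + (f t).e23 + ((l.length : ℤ) - 1 - j) * r := by
  induction l with
  | nil => exact absurd rfl hl
  | cons c l ih =>
    rcases eq_or_ne l [] with rfl | hl'
    · exact Or.inl ⟨0, c, rfl, by simp⟩
    rw [prod_e13_cons hp hr]
    rcases max_choice (p + (l.map f).prod.e13)
      (max ((f c).e12 + (l.map f).prod.e23) ((f c).e13 + (l.length : ℤ) * r)) with h | h
    · rw [h]
      rcases ih hl' with ⟨i, s, hi, he⟩ | ⟨i, j, s, t, hij, hi, hj, he⟩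
      · refine Or.inl ⟨i + 1, s, by simpa using hi, ?_⟩
        rw [he]; push_cast [List.length_cons]; ring
      · refine Or.inr ⟨i + 1, j + 1, s, t, by omega, by simpa using hi, by simpa using hj, ?_⟩
        rw [he]; push_cast [List.length_cons]; ring
    · rw [h]
      rcases max_choice ((f c).e12 + (l.map f).prod.e23) ((f c).e13 + (l.length : ℤ) * r)
        with h' | h'
      · obtain ⟨j, t, hj, he⟩ := exists_single_jump_eq (g := fun l => (l.map f).prod.e23)
          (v := fun s => (f s).e23) (p := q) (q := r) (fun s => by simp)
          (fun s l => prod_e23_cons hq hr s l) hl'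
        refine Or.inr ⟨0, j + 1, c, t, by omega, rfl, by simpa using hj, ?_⟩
        rw [h', he]; push_cast [List.length_cons]; ring
      · exact Or.inl ⟨0, c, rfl, by rw [h']; simp⟩

lemma HasAllPairs.e13_mono {w : List ι} (hw : HasAllPairs w) (hp : ∀ s, (f s).e11 = p)
    (hq : ∀ s, (f s).e22 = q) (hr : ∀ s, (f s).e33 = r) (a b : ι) :
    ((w ++ a :: w).map f).prod.e13 ≤ ((w ++ b :: w).map f).prod.e13 := by
  rcases exists_jump_eq hp hq hr (l := w ++ a :: w) (by simp) with
    ⟨i, s, hi, he⟩ | ⟨i, j, s, t, hij, hi, hj, he⟩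
  · obtain ⟨i', hi', hle⟩ := hw.exists_single a b (p - r) hi
    have := single_jump_le (g := fun l => (l.map f).prod.e13) (v := fun s => (f s).e13)
      (p := p) (q := r)
      (fun s l => by simp only [prod_e13_cons hp hr]; exact le_max_left _ _)
      (fun s l => by
        simp only [prod_e13_cons hp hr]
        exact (le_max_right _ _).trans (le_max_right _ _)) hi'
    rw [he]
    refine le_trans ?_ this
    simp only [List.length_append, List.length_cons]
    linarith
  · obtain ⟨i', j', hij', hi', hj', hle⟩ := hw.exists_double a b (p - q) (q - r) hij hi hj
    rw [he]
    refine le_trans ?_ (double_jump_le hp hq hr hij' hi' hj')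
    simp only [List.length_append, List.length_cons]
    linarith

/-- If all the matrices have the same diagonal and every word of length two is a factor of `w`,
then the product along `w a w` does not depend on the letter `a`. -/
lemma HasAllPairs.prod_eq {w : List ι} (hw : HasAllPairs w) (hp : ∀ s, (f s).e11 = p)
    (hq : ∀ s, (f s).e22 = q) (hr : ∀ s, (f s).e33 = r) (a b : ι) :
    ((w ++ a :: w).map f).prod = ((w ++ b :: w).map f).prod := by
  have h12 (a b : ι) := hw.single_jump_mono (g := fun l => (l.map f).prod.e12)
    (v := fun s => (f s).e12) a b (fun s => by simp) (fun s l => prod_e12_cons hp hq s l)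
  have h23 (a b : ι) := hw.single_jump_mono (g := fun l => (l.map f).prod.e23)
    (v := fun s => (f s).e23) a b (fun s => by simp) (fun s l => prod_e23_cons hq hr s l)
  ext
  · rw [prod_e11 hp, prod_e11 hp]; simp
  · exact le_antisymm (h12 a b) (h12 b a)
  · exact le_antisymm (hw.e13_mono hp hq hr a b) (hw.e13_mono hp hq hr b a)
  · rw [prod_e22 hq, prod_e22 hq]; simp
  · exact le_antisymm (h23 a b) (h23 b a)
  · rw [prod_e33 hr, prod_e33 hr]; simp

end Products

/-! ## Identities in the plactic monoid of rank three -/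

/-- Diagonal entries add under multiplication, so `u * v` and `v * u` have the same diagonal and
`HasAllPairs.prod_eq` applies. -/
lemma HasAllPairs.rep_eq (ρ : PlacticMonoid (Fin 3) →* MonoTri) {w : List (Fin 2)}
    (hw : HasAllPairs w) (u v : PlacticMonoid (Fin 3)) (a b : Fin 2) :
    ρ ((w ++ a :: w).map ![u * v, v * u]).prod = ρ ((w ++ b :: w).map ![u * v, v * u]).prod := by
  rw [map_list_prod, map_list_prod, List.map_map, List.map_map]
  refine hw.prod_eq (p := (ρ u).e11 + (ρ v).e11) (q := (ρ u).e22 + (ρ v).e22)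
    (r := (ρ u).e33 + (ρ v).e33) ?_ ?_ ?_ a b <;>
  · intro s
    fin_cases s <;> simp [add_comm]

lemma HasAllPairs.plactic_eq {w : List (Fin 2)} (hw : HasAllPairs w)
    (u v : PlacticMonoid (Fin 3)) (a b : Fin 2) :
    ((w ++ a :: w).map ![u * v, v * u]).prod = ((w ++ b :: w).map ![u * v, v * u]).prod :=
  eq_of_rowRep_eq_of_pairRep_eq (hw.rep_eq rowRep u v a b) (hw.rep_eq pairRep u v a b)

lemma runsAtMost_of_length_le {C : Type*} {p : ℕ} {w : FreeMonoid C} (h : w.length ≤ p) :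
    RunsAtMost p w := by
  rintro a q hq ⟨v₁, v₂, rfl⟩
  have hpow (n : ℕ) : (FreeMonoid.of a ^ n).length = n := by
    induction n with
    | zero => rfl
    | succ n ih => rw [pow_succ, FreeMonoid.length_mul, ih, FreeMonoid.length_of]
  simp only [FreeMonoid.length_mul, hpow] at h
  omega

/-- A word of length two cannot violate a run bound of at least two, so all of them are required as
factors. -/
lemma IsPowerWord.hasAllPairs {C : Type*} {p : ℕ} (hp : 2 ≤ p) {w : FreeMonoid C}
    (hw : IsPowerWord p 2 w) : HasAllPairs w.toList := by
  intro s t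
  obtain ⟨v₁, v₂, rfl⟩ := hw.factors (.of s * .of t) rfl (runsAtMost_of_length_le (by exact hp))
  refine ⟨v₁.toList.length, ?_, ?_⟩ <;>
    simp [FreeMonoid.toList_mul, FreeMonoid.toList_of]

/-- The word `y x² y² x`, where `0` stands for `x` and `1` for `y`. -/
lemma hasAllPairs_yxxyyx : HasAllPairs ([1, 0, 0, 1, 1, 0] : List (Fin 2)) := by
  intro s t
  fin_cases s <;> fin_cases t
  · exact ⟨1, rfl, rfl⟩
  · exact ⟨2, rfl, rfl⟩
  · exact ⟨0, rfl, rfl⟩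
  · exact ⟨3, rfl, rfl⟩

theorem mainTheorem2 :
    (∀ {α : Type*} (u v : FreeSemigroup α),
      SatisfiesIdentity (TMat 3) u v → SatisfiesIdentity (PlacticMonoid (Fin 3)) u v) ∧
    (∀ w : FreeMonoid (Fin 2),
      IsUniformWord w → IsPowerWord 2 2 w →
      IsPowerWord 2 2 (w * FreeMonoid.of 0 * w) → IsPowerWord 2 2 (w * FreeMonoid.of 1 * w) →
      ∀ u v : PlacticMonoid (Fin 3),
        FreeMonoid.lift ![u * v, v * u] (w * FreeMonoid.of 0 * w) =
          FreeMonoid.lift ![u * v, v * u] (w * FreeMonoid.of 1 * w)) ∧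
    (∀ u v x y : PlacticMonoid (Fin 3), x = u * v → y = v * u →
      (y * x ^ 2 * y ^ 2 * x) * x * (y * x ^ 2 * y ^ 2 * x) =
        (y * x ^ 2 * y ^ 2 * x) * y * (y * x ^ 2 * y ^ 2 * x)) := by
  refine ⟨fun u v h => satisfiesIdentity_plactic h, fun w _ hw _ _ u v => ?_, ?_⟩
  · have := (hw.hasAllPairs le_rfl).plactic_eq u v 0 1
    simpa [FreeMonoid.lift_apply, FreeMonoid.toList_mul, mul_assoc] using this
  · rintro u v x y rfl rfl
    have := hasAllPairs_yxxyyx.plactic_eq u v 0 1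
    simpa [pow_two, mul_assoc] using this
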